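/- Let $n,m$ be nonnegative integers. A correlation is a tuple $p=(p(i,j|x,y))_{1\le i,j\le m,\,1\le x,y\le n}$ of nonnegative reals with $\sum_{i,j}p(i,j|x,y)=1$ for all $x,y$; it is synchronous if $p(i,j|x,x)=0$ for all $x$ and all $i\neq j$, and nonsignalling if $\sum_j p(i,j|x,y)$ does not depend on $y$ and $\sum_i p(i,j|x,y)$ does not depend on $x$. A correlation $p$ is a quantum correlation if there are finite-dimensional complex Hilbert spaces $H_A,H_B$, projection-valued measures $\{E_{x,i}\}_{i=1}^m\subset B(H_A)$ and $\{F_{y,j}\}_{j=1}^m\subset B(H_B)$ for $1\le x,y\le n$ (that is, orthogonal projections with $\sum_i E_{x,i}=I$ and $\sum_j F_{y,j}=I$), and a unit vector $\phi\in H_A\otimes H_B$ such that $p(i,j|x,y)=\langle (E_{x,i}\otimes F_{y,j})\phi,\phi\rangle$ for all $i,j,x,y$. For $d\ge 1$ let $C^s_{max,d}$ be the set of synchronous correlations that admit such a representation with $\dim H_A=\dim H_B=d$ and $\phi=\frac1{\sqrt d}\sum_{k=1}^d u_k\otimes v_k$ for some orthonormal bases $\{u_k\}$ of $H_A$ and $\{v_k\}$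 of $H_B$. Let $C_q^s$ be the set of synchronous quantum correlations, and let $C_{loc}^s$ be the set of synchronous elements of $C_{loc}$, the closed convex hull of the set of nonsignalling correlations all of whose entries lie in $\{0,1\}$. For each positive integer $k$, let $C_k^s:=\mathrm{co}(C^s_{max,k!})$ be the convex hull of $C^s_{max,k!}$ in $\mathbb{R}^{m^2n^2}$. Then for each $k\ge 1$ the set $C_k^s$ is closed and convex, and $C_k^s\subseteq C_{k+1}^s$. Moreover $\bigcup_{k=1}^\infty C_k^s=C_q^s$ and $C_1^s=C_{loc}^s$. -/

import Mathlib

open scoped TensorProduct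

/-- Tuples `p i j x y`, standing for `p(i,j|x,y)`, with the product topology and pointwise
operations of the finite-dimensional space `ℝ^(m × m × nA × nB)`. -/
abbrev Tuple (nA nB m : ℕ) : Type := Fin m → Fin m → Fin nA → Fin nB → ℝ

/-- The set of correlations. -/
def corr (nA nB m : ℕ) : Set (Tuple nA nB m) :=
  {p | (∀ i j x y, 0 ≤ p i j x y) ∧ ∀ x y, ∑ i, ∑ j, p i j x y = 1}

/-- The marginals `∑ j, p(i,j|x,y)` and `∑ i, p(i,j|x,y)` do not depend on `y`, resp. `x`. -/
def IsNonsignalling {nA nB m : ℕ} (p : Tuple nA nB m) : Prop :=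
  (∀ i x y y', ∑ j, p i j x y = ∑ j, p i j x y') ∧
    ∀ j y x x', ∑ i, p i j x y = ∑ i, p i j x' y

/-- Synchronous tuples: `p(i,j|x,x) = 0` for `i ≠ j`. -/
def IsSynchronous {n m : ℕ} (p : Tuple n n m) : Prop :=
  ∀ x i j, i ≠ j → p i j x x = 0

/-- Deterministic correlations: nonsignalling correlations with all values in `{0, 1}`. -/
def deterministicCorr (nA nB m : ℕ) : Set (Tuple nA nB m) :=
  {p | p ∈ corr nA nB m ∧ IsNonsignalling p ∧ ∀ i j x y, p i j x y = 0 ∨ p i j x y = 1}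

/-- Local correlations: the closed convex hull of the deterministic ones. -/
def locCorr (nA nB m : ℕ) : Set (Tuple nA nB m) :=
  closedConvexHull ℝ (deterministicCorr nA nB m)

/-- Projection-valued measures with `m` outcomes on a finite-dimensional Hilbert space:
`P k * P k = P k`, `star (P k) = P k` (the adjoint), and the sum is the identity. -/
def IsPVM {H : Type*} [NormedAddCommGroup H] [InnerProductSpace ℂ H] [FiniteDimensional ℂ H]
    {m : ℕ} (P : Fin m → (H →ₗ[ℂ] H)) : Prop :=
  (∀ k, IsStarProjection (P k)) ∧ ∑ k, P k = 1

/-- `(HA, HB, E, F, φ)` is a representation of `p`: `φ` is a unit vector of the Hilbert space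
tensor product and `p(i,j|x,y) = ⟨(E x i ⊗ F y j) φ, φ⟩`. (Mathlib's inner product is linear in
the second variable.) -/
def IsRepresentation {nA nB m : ℕ} (p : Tuple nA nB m)
    {HA HB : Type*} [NormedAddCommGroup HA] [InnerProductSpace ℂ HA] [FiniteDimensional ℂ HA]
    [NormedAddCommGroup HB] [InnerProductSpace ℂ HB] [FiniteDimensional ℂ HB]
    (E : Fin nA → Fin m → (HA →ₗ[ℂ] HA)) (F : Fin nB → Fin m → (HB →ₗ[ℂ] HB))
    (φ : HA ⊗[ℂ] HB) : Prop :=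
  (∀ x, IsPVM (E x)) ∧ (∀ y, IsPVM (F y)) ∧ ‖φ‖ = 1 ∧
    ∀ i j x y, (p i j x y : ℂ) = inner ℂ φ (TensorProduct.map (E x i) (F y j) φ)

/-- Maximally entangled vectors in `HA ⊗ HB`, where `dim HA = dim HB = d`. -/
def IsMaximallyEntangled {HA HB : Type*} [NormedAddCommGroup HA] [InnerProductSpace ℂ HA]
    [NormedAddCommGroup HB] [InnerProductSpace ℂ HB] (d : ℕ) (φ : HA ⊗[ℂ] HB) : Prop :=
  ∃ (u : OrthonormalBasis (Fin d) ℂ HA) (v : OrthonormalBasis (Fin d) ℂ HB),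
    φ = ((1 / Real.sqrt d : ℝ) : ℂ) • ∑ k, u k ⊗ₜ[ℂ] v k

/-- Quantum correlations. (Every finite-dimensional Hilbert space is isometrically isomorphic to
some `EuclideanSpace ℂ (Fin d)`, so it is enough to let the spaces range over `Type`.) -/
def qCorr (nA nB m : ℕ) : Set (Tuple nA nB m) :=
  {p | p ∈ corr nA nB m ∧
    ∃ (HA HB : Type) (_ : NormedAddCommGroup HA) (_ : InnerProductSpace ℂ HA)
      (_ : FiniteDimensional ℂ HA) (_ : NormedAddCommGroup HB) (_ : InnerProductSpace ℂ HB)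
      (_ : FiniteDimensional ℂ HB)
      (E : Fin nA → Fin m → (HA →ₗ[ℂ] HA)) (F : Fin nB → Fin m → (HB →ₗ[ℂ] HB))
      (φ : HA ⊗[ℂ] HB), IsRepresentation p E F φ}

/-- `C_{max,d}`: correlations with a representation on Hilbert spaces of dimension `d` whose
vector is maximally entangled. -/
def maxCorr (nA nB m d : ℕ) : Set (Tuple nA nB m) :=
  {p | p ∈ corr nA nB m ∧
    ∃ (HA HB : Type) (_ : NormedAddCommGroup HA) (_ : InnerProductSpace ℂ HA)
      (_ : FiniteDimensional ℂ HA) (_ : NormedAddCommGroup HB) (_ : InnerProductSpace ℂ HB)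
      (_ : FiniteDimensional ℂ HB)
      (E : Fin nA → Fin m → (HA →ₗ[ℂ] HA)) (F : Fin nB → Fin m → (HB →ₗ[ℂ] HB))
      (φ : HA ⊗[ℂ] HB), IsRepresentation p E F φ ∧ IsMaximallyEntangled d φ}

/-- `C_loc^s(n,m)`. -/
def locCorrSync (n m : ℕ) : Set (Tuple n n m) := {p | p ∈ locCorr n n m ∧ IsSynchronous p}

/-- `C_q^s(n,m)`. -/
def qCorrSync (n m : ℕ) : Set (Tuple n n m) := {p | p ∈ qCorr n n m ∧ IsSynchronous p}

/-- `C_{max,d}^s(n,m)`. -/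
def maxCorrSync (n m d : ℕ) : Set (Tuple n n m) := {p | p ∈ maxCorr n n m d ∧ IsSynchronous p}

/-- `C_k^s(n,m) = co(C_{max,k!}^s(n,m))`. -/
def hullCorrSync (n m k : ℕ) : Set (Tuple n n m) := convexHull ℝ (maxCorrSync n m k.factorial)

/-! In coordinates a vector of `HA ⊗ HB` is a matrix `Φ`, and p(i,j|x,y) = tr(Φᴴ E_{x,i} Φ G_{y,j})
with G = Fᵀ, the squared Hilbert–Schmidt norm of E_{x,i} Φ G_{y,j}. Synchronicity kills these
products for x = y, i ≠ j, which forces E_{x,i} Φ = Φ G_{x,i} (`IsMatrixPVM.intertwine`).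

If `Φ` is a nonzero scalar matrix, then G = E, so C^s_{max,d} consists of the normalised traces
tr(E_{x,i} E_{y,j})/d (`mem_maxCorrSync_iff`). The tuples of PVMs of size d form a compact set, so
C^s_{max,d} is compact, and so is its hull by Carathéodory. Amplifying E to E ⊗ 1 gives C^s_{max,d}
⊆ C^s_{max,dr}; with k! ∣ (k+1)! the hulls increase.

For general `Φ`, the density matrix ρ = ΦΦᴴ commutes with every E_{x,i}. Its eigenspaces therefore
reduce all the projections, and p is a convex combination of tracial correlations, one per
eigenvalue (`qCorrSync_subset_convexHull`). Their sizes d vary, but d ∣ d! places all of them in the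
increasing union. Conversely, direct sums make the quantum correlations convex.

In dimension one, PVMs are 0/1-valued, so C^s_{max,1} is the set of synchronous deterministic
correlations. Synchronous correlations form a face, so imposing synchronicity commutes with taking
hulls, which settles k = 1. -/

open scoped ComplexOrder

/-- Projection-valued measures whose values are complex matrices. -/
def IsMatrixPVM {α : Type*} [Fintype α] [DecidableEq α] {m : ℕ}
    (P : Fin m → Matrix α α ℂ) : Prop :=
  (∀ k, IsStarProjection (P k)) ∧ ∑ k, P k = 1

/-- A representation in matrix form: `p(i,j|x,y) = tr(Φᴴ E_{x,i} Φ G_{y,j})`, `tr(Φᴴ Φ) = 1`. -/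
def IsMatrixRep {nA nB m : ℕ} (p : Tuple nA nB m) {α β : Type*} [Fintype α] [DecidableEq α]
    [Fintype β] [DecidableEq β] (E : Fin nA → Fin m → Matrix α α ℂ)
    (G : Fin nB → Fin m → Matrix β β ℂ) (Φ : Matrix α β ℂ) : Prop :=
  (∀ x, IsMatrixPVM (E x)) ∧ (∀ y, IsMatrixPVM (G y)) ∧ (Φ.conjTranspose * Φ).trace = 1 ∧
    ∀ i j x y, (p i j x y : ℂ) = (Φ.conjTranspose * E x i * Φ * G y j).trace

/-- The vector of a tensor product of Hilbert spaces with given matrix of coordinates. -/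
noncomputable def tensorOfMatrix {HA HB : Type*} [NormedAddCommGroup HA] [InnerProductSpace ℂ HA]
    [NormedAddCommGroup HB] [InnerProductSpace ℂ HB] {α β : Type*} [Fintype α] [Fintype β]
    (a : OrthonormalBasis α ℂ HA) (b : OrthonormalBasis β ℂ HB) (Φ : Matrix α β ℂ) :
    HA ⊗[ℂ] HB :=
  ∑ k, ∑ l, (Φ k l • a k) ⊗ₜ[ℂ] b l

open Matrix

theorem Matrix.trace_fromBlocks_eq {α β R : Type*} [Fintype α] [Fintype β] [AddCommMonoid R]
    (A : Matrix α α R) (B : Matrix α β R) (C : Matrix β α R) (D : Matrix β β R) :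
    (fromBlocks A B C D).trace = A.trace + D.trace := by
  simp [trace, Fintype.sum_sum_type]

/-! ### Matrix projections and the intertwining relation -/

section Projections

variable {α β : Type*} [Fintype α] [DecidableEq α] [Fintype β] [DecidableEq β] {m : ℕ}

omit [DecidableEq α] in
theorem isStarProjection_matrix_iff {P : Matrix α α ℂ} :
    IsStarProjection P ↔ P * P = P ∧ Pᴴ = P :=
  isStarProjection_iff'

theorem IsMatrixPVM.mul_self {P : Fin m → Matrix α α ℂ} (h : IsMatrixPVM P) (k : Fin m) :
    P k * P k = P k := (isStarProjection_matrix_iff.1 (h.1 k)).1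

theorem IsMatrixPVM.conjTranspose {P : Fin m → Matrix α α ℂ} (h : IsMatrixPVM P) (k : Fin m) :
    (P k)ᴴ = P k := (isStarProjection_matrix_iff.1 (h.1 k)).2

theorem IsMatrixPVM.transpose {P : Fin m → Matrix α α ℂ} (h : IsMatrixPVM P) :
    IsMatrixPVM fun k => (P k)ᵀ := by
  refine ⟨fun k => isStarProjection_matrix_iff.2 ⟨?_, ?_⟩, ?_⟩
  · rw [← transpose_mul, h.mul_self]
  · ext i j
    simpa using congrFun (congrFun (h.conjTranspose k) j) i
  · rw [← transpose_sum, h.2, transpose_one]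

theorem IsMatrixPVM.map {P : Fin m → Matrix α α ℂ} (h : IsMatrixPVM P)
    (f : Matrix α α ℂ ≃⋆ₐ[ℂ] Matrix β β ℂ) : IsMatrixPVM fun k => f (P k) :=
  ⟨fun k => (h.1 k).map f, by rw [← map_sum, h.2, map_one]⟩

theorem IsMatrixPVM.submatrix {P : Fin m → Matrix α α ℂ} (h : IsMatrixPVM P) (e : β ≃ α) :
    IsMatrixPVM fun k => (P k).submatrix e e := by
  refine ⟨fun k => isStarProjection_matrix_iff.2 ⟨?_, ?_⟩, ?_⟩
  · rw [submatrix_mul_equiv, h.mul_self]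
  · rw [conjTranspose_submatrix, h.conjTranspose]
  · ext i j
    have := congrFun (congrFun h.2 (e i)) (e j)
    simp only [Matrix.sum_apply, submatrix_apply] at this ⊢
    rw [this]
    simp [Matrix.one_apply]

theorem IsMatrixPVM.kronecker_one {P : Fin m → Matrix α α ℂ} (h : IsMatrixPVM P) :
    IsMatrixPVM fun k => kroneckerMap (· * ·) (P k) (1 : Matrix β β ℂ) := by
  refine ⟨fun k => isStarProjection_matrix_iff.2 ⟨?_, ?_⟩, ?_⟩
  · rw [← mul_kronecker_mul, h.mul_self, one_mul]
  · rw [conjTranspose_kronecker, h.conjTranspose, conjTranspose_one]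
  · ext ⟨i, i'⟩ ⟨j, j'⟩
    have := congrFun (congrFun h.2 i) j
    simp only [Matrix.sum_apply, kroneckerMap_apply] at this ⊢
    rw [← Finset.sum_mul, this]
    simp [Matrix.one_apply, Prod.ext_iff, ← ite_and, and_comm]

theorem IsMatrixPVM.fromBlocks {P : Fin m → Matrix α α ℂ} {Q : Fin m → Matrix β β ℂ}
    (hP : IsMatrixPVM P) (hQ : IsMatrixPVM Q) :
    IsMatrixPVM fun k => fromBlocks (P k) 0 0 (Q k) := by
  refine ⟨fun k => isStarProjection_matrix_iff.2 ⟨?_, ?_⟩, ?_⟩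
  · simp [fromBlocks_multiply, hP.mul_self, hQ.mul_self]
  · simp [fromBlocks_conjTranspose, hP.conjTranspose, hQ.conjTranspose]
  · rw [← fromBlocks_one, ← hP.2, ← hQ.2]
    ext (i | i) (j | j) <;> simp [Matrix.sum_apply]

/-- Compression to an eigenspace of a diagonal matrix is multiplicative if the left factor commutes
with the diagonal matrix. -/
theorem submatrix_mul_of_commute_diagonal {A B : Matrix α α ℂ} {w : α → ℝ}
    (hA : Commute (diagonal fun k => (w k : ℂ)) A) (μ : ℝ) :
    (A * B).submatrix (fun k : {k // w k = μ} => k.1) (fun k : {k // w k = μ} => k.1) =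
      A.submatrix (fun k : {k // w k = μ} => k.1) (fun k : {k // w k = μ} => k.1) *
        B.submatrix (fun k : {k // w k = μ} => k.1) (fun k : {k // w k = μ} => k.1) := by
  ext ⟨i, hi⟩ ⟨j, hj⟩
  simp only [submatrix_apply, Matrix.mul_apply]
  rw [← Finset.sum_subtype (Finset.univ.filter fun k => w k = μ) (by simp)
    (fun k => A i k * B k j)]
  refine (Finset.sum_filter_of_ne fun k _ hk => ?_).symm
  by_contra hne
  apply hk
  -- Entrywise, commutation says (w i - w k) * A i k = 0, so `A` has no entries between different
  -- eigenspaces.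
  have h := congrFun (congrFun hA.eq i) k
  rw [diagonal_mul, mul_diagonal, mul_comm (A i k)] at h
  have h0 : ((w i : ℂ) - w k) * A i k = 0 := by rw [sub_mul, h, sub_self]
  rcases mul_eq_zero.1 h0 with h1 | h1
  · exact absurd ((Complex.ofReal_injective (sub_eq_zero.1 h1)).symm.trans hi) hne
  · rw [h1, zero_mul]

theorem IsMatrixPVM.compress {P : Fin m → Matrix α α ℂ} (h : IsMatrixPVM P) {w : α → ℝ}
    (hw : ∀ k, Commute (diagonal fun k => (w k : ℂ)) (P k)) (μ : ℝ) :
    IsMatrixPVM fun k => (P k).submatrix (fun k : {k // w k = μ} => k.1)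
      (fun k : {k // w k = μ} => k.1) := by
  refine ⟨fun k => isStarProjection_matrix_iff.2 ⟨?_, ?_⟩, ?_⟩
  · rw [← submatrix_mul_of_commute_diagonal (hw k), h.mul_self]
  · rw [conjTranspose_submatrix, h.conjTranspose]
  · ext i j
    have := congrFun (congrFun h.2 i.1) j.1
    simp only [Matrix.sum_apply, submatrix_apply] at this ⊢
    rw [this]
    simp [Matrix.one_apply, Subtype.ext_iff]

/-- From P = PᴴP, the diagonal entry P j j is the sum of the squared moduli of column j. It
dominates its own squared modulus, hence is at most one, and then bounds every entry of the column.
-/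
theorem IsMatrixPVM.norm_apply_le_one {P : Fin m → Matrix α α ℂ} (h : IsMatrixPVM P) (k : Fin m)
    (i j : α) : ‖P k i j‖ ≤ 1 := by
  have key : ∀ j, (P k j j).re = ∑ l, ‖P k l j‖ ^ 2 := fun j => by
    have h1 : ((P k)ᴴ * P k) j j = P k j j := by rw [h.conjTranspose, h.mul_self]
    rw [← h1, Matrix.mul_apply, Complex.re_sum]
    refine Finset.sum_congr rfl fun l _ => ?_
    rw [conjTranspose_apply, Complex.star_def, Complex.conj_mul', ← Complex.ofReal_pow,
      Complex.ofReal_re]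
  have hle : ∀ l, ‖P k l j‖ ^ 2 ≤ (P k j j).re := fun l => by
    rw [key]
    exact Finset.single_le_sum (f := fun l => ‖P k l j‖ ^ 2) (fun _ _ => by positivity)
      (Finset.mem_univ l)
  have h2 := Complex.re_le_norm (P k j j)
  have h3 := hle j
  have h4 := hle i
  have h5 : ‖P k j j‖ ≤ 1 := by
    by_contra hc
    nlinarith [norm_nonneg (P k j j)]
  by_contra hc
  nlinarith [norm_nonneg (P k i j)]

omit [DecidableEq α] [DecidableEq β] in
-- Cyclicity of the trace and idempotence. Written as a squared norm, a probability is nonnegative,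
-- and it vanishes only if `E * Φ * G = 0`.
theorem trace_conjTranspose_mul_self_of_projections {E : Matrix α α ℂ} {G : Matrix β β ℂ}
    (hE : IsStarProjection E) (hG : IsStarProjection G) (Φ : Matrix α β ℂ) :
    ((E * Φ * G)ᴴ * (E * Φ * G)).trace = (Φᴴ * E * Φ * G).trace := by
  rw [isStarProjection_matrix_iff] at hE hG
  rw [conjTranspose_mul, conjTranspose_mul, hE.2, hG.2, Matrix.mul_assoc, trace_mul_comm]
  simp only [Matrix.mul_assoc]
  rw [hG.1, ← Matrix.mul_assoc E E, hE.1]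

omit [DecidableEq α] [DecidableEq β] in
theorem trace_projections_nonneg {E : Matrix α α ℂ} {G : Matrix β β ℂ}
    (hE : IsStarProjection E) (hG : IsStarProjection G) (Φ : Matrix α β ℂ) :
    ∃ r : ℝ, 0 ≤ r ∧ (Φᴴ * E * Φ * G).trace = r := by
  rw [← trace_conjTranspose_mul_self_of_projections hE hG]
  have h := (posSemidef_conjTranspose_mul_self (E * Φ * G)).trace_nonneg
  rw [Complex.le_def] at h
  exact ⟨_, h.1, Complex.ext rfl (by simpa using h.2.symm)⟩

/-- The hypothesis gives `E i * Φ * G j = 0` off the diagonal. Inserting ∑ G j = 1 on the right of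
`E i * Φ`, or ∑ E j = 1 on the left of `Φ * G i`, leaves `E i * Φ * G i` in both cases. -/
theorem IsMatrixPVM.intertwine {E : Fin m → Matrix α α ℂ} {G : Fin m → Matrix β β ℂ}
    (hE : IsMatrixPVM E) (hG : IsMatrixPVM G) {Φ : Matrix α β ℂ}
    (h : ∀ i j, i ≠ j → (Φᴴ * E i * Φ * G j).trace = 0) (i : Fin m) : E i * Φ = Φ * G i := by
  have h0 : ∀ i j, i ≠ j → E i * Φ * G j = 0 := fun i j hij => by
    have := h i j hij
    rw [← trace_conjTranspose_mul_self_of_projections (hE.1 i) (hG.1 j)] at this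
    exact trace_conjTranspose_mul_self_eq_zero_iff.1 this
  have h1 : E i * Φ = E i * Φ * G i := by
    conv_lhs => rw [← Matrix.mul_one (E i * Φ), ← hG.2, Matrix.mul_sum]
    exact Finset.sum_eq_single i (fun j _ hj => h0 i j hj.symm) (by simp)
  have h2 : Φ * G i = E i * Φ * G i := by
    conv_lhs => rw [← Matrix.one_mul (Φ * G i), ← hE.2, Matrix.sum_mul]
    simp only [← Matrix.mul_assoc]
    exact Finset.sum_eq_single i (fun j _ hj => h0 j i hj) (by simp)
  rw [h1, h2]

end Projections

/-! ### Representations in coordinates -/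

section Representations

variable {nA nB m : ℕ} {α β : Type*} [Fintype α] [DecidableEq α] [Fintype β] [DecidableEq β]
  {p : Tuple nA nB m}

theorem IsMatrixRep.mem_corr {E : Fin nA → Fin m → Matrix α α ℂ}
    {G : Fin nB → Fin m → Matrix β β ℂ} {Φ : Matrix α β ℂ} (h : IsMatrixRep p E G Φ) :
    p ∈ corr nA nB m := by
  obtain ⟨hE, hG, hΦ, hp⟩ := h
  refine ⟨fun i j x y => ?_, fun x y => ?_⟩
  · obtain ⟨r, hr, h⟩ := trace_projections_nonneg ((hE x).1 i) ((hG y).1 j) Φ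
    rw [← hp] at h
    exact_mod_cast (Complex.ofReal_injective h).symm ▸ hr
  · have : ((∑ i, ∑ j, p i j x y : ℝ) : ℂ) = 1 := by
      push_cast
      simp only [hp, ← trace_sum, ← Matrix.mul_sum, (hG y).2, Matrix.mul_one, ← Matrix.sum_mul,
        (hE x).2, hΦ]
    exact_mod_cast this

/-- The second factor acts on the column index of `Φ`, so E ⊗ F sends `Φ` to E Φ Fᵀ; hence the
transpose. -/
theorem inner_tensorOfMatrix {HA HB : Type*} [NormedAddCommGroup HA] [InnerProductSpace ℂ HA]
    [FiniteDimensional ℂ HA] [NormedAddCommGroup HB] [InnerProductSpace ℂ HB]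
    [FiniteDimensional ℂ HB] (a : OrthonormalBasis α ℂ HA) (b : OrthonormalBasis β ℂ HB)
    (Φ : Matrix α β ℂ) (E : HA →ₗ[ℂ] HA) (F : HB →ₗ[ℂ] HB) :
    inner ℂ (tensorOfMatrix a b Φ) (TensorProduct.map E F (tensorOfMatrix a b Φ)) =
      (Φᴴ * LinearMap.toMatrixOrthonormal a E * Φ *
        (LinearMap.toMatrixOrthonormal b F)ᵀ).trace := by
  simp only [tensorOfMatrix, map_sum, map_smul, TensorProduct.map_tmul, sum_inner, inner_sum,
    inner_smul_left, inner_smul_right, TensorProduct.inner_tmul, Matrix.trace, Matrix.diag_apply,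
    Matrix.mul_apply, Finset.sum_mul, conjTranspose_apply, transpose_apply,
    LinearMap.toMatrixOrthonormal_apply_apply]
  simp only [Finset.sum_comm (s := (Finset.univ : Finset α)) (t := (Finset.univ : Finset β))]
  rw [Finset.sum_comm]
  refine Finset.sum_congr rfl fun l _ => Finset.sum_congr rfl fun l' _ =>
    Finset.sum_congr rfl fun k _ => Finset.sum_congr rfl fun k' _ => ?_
  rw [Complex.star_def]
  ring

theorem isPVM_iff_isMatrixPVM {H : Type*} [NormedAddCommGroup H] [InnerProductSpace ℂ H]
    [FiniteDimensional ℂ H] (a : OrthonormalBasis α ℂ H) (P : Fin m → (H →ₗ[ℂ] H)) :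
    IsPVM P ↔ IsMatrixPVM fun k => LinearMap.toMatrixOrthonormal a (P k) := by
  constructor
  · intro h
    exact ⟨fun k => (h.1 k).map _, by rw [← map_sum, h.2, map_one]⟩
  · intro h
    refine ⟨fun k => ?_, ?_⟩
    · simpa using (h.1 k).map (LinearMap.toMatrixOrthonormal a).symm
    · apply (LinearMap.toMatrixOrthonormal a).injective
      exact (map_sum (LinearMap.toMatrixOrthonormal a) P _).trans (h.2.trans (map_one _).symm)

theorem isRepresentation_iff {HA HB : Type*} [NormedAddCommGroup HA] [InnerProductSpace ℂ HA]
    [FiniteDimensional ℂ HA] [NormedAddCommGroup HB] [InnerProductSpace ℂ HB]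
    [FiniteDimensional ℂ HB] (a : OrthonormalBasis α ℂ HA) (b : OrthonormalBasis β ℂ HB)
    (Φ : Matrix α β ℂ) (E : Fin nA → Fin m → (HA →ₗ[ℂ] HA)) (F : Fin nB → Fin m → (HB →ₗ[ℂ] HB)) :
    IsRepresentation p E F (tensorOfMatrix a b Φ) ↔
      IsMatrixRep p (fun x i => LinearMap.toMatrixOrthonormal a (E x i))
        (fun y j => (LinearMap.toMatrixOrthonormal b (F y j))ᵀ) Φ := by
  unfold IsRepresentation IsMatrixRep
  refine and_congr (forall_congr' fun x => isPVM_iff_isMatrixPVM a _)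
    (and_congr (forall_congr' fun y => ?_) (and_congr ?_ ?_))
  · rw [isPVM_iff_isMatrixPVM b]
    exact ⟨fun h => h.transpose, fun h => by simpa using h.transpose⟩
  -- Identity operators turn the formula into ‖φ‖² = tr(ΦᴴΦ).
  · have h := inner_tensorOfMatrix a b Φ 1 1
    rw [map_one, map_one, transpose_one, Matrix.mul_one, Matrix.mul_one, TensorProduct.map_one,
      Module.End.one_apply] at h
    have h' := h.symm.trans (inner_self_eq_norm_sq_to_K (𝕜 := ℂ) (tensorOfMatrix a b Φ))
    rw [h']
    constructor
    · intro h1; rw [h1]; simp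
    · intro h1
      have h2 : ‖tensorOfMatrix a b Φ‖ ^ 2 = 1 := Complex.ofReal_injective (by simpa using h1)
      exact (pow_eq_one_iff_of_nonneg (norm_nonneg _) two_ne_zero).1 h2
  · simp only [inner_tensorOfMatrix]

omit [DecidableEq α] [DecidableEq β] in
theorem exists_tensorOfMatrix {HA HB : Type*} [NormedAddCommGroup HA] [InnerProductSpace ℂ HA]
    [NormedAddCommGroup HB] [InnerProductSpace ℂ HB]
    (a : OrthonormalBasis α ℂ HA) (b : OrthonormalBasis β ℂ HB) (φ : HA ⊗[ℂ] HB) :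
    ∃ Φ : Matrix α β ℂ, φ = tensorOfMatrix a b Φ := by
  refine ⟨Matrix.of fun k l => (a.toBasis.tensorProduct b.toBasis).repr φ (k, l), ?_⟩
  conv_lhs => rw [← (a.toBasis.tensorProduct b.toBasis).sum_repr φ]
  rw [Fintype.sum_prod_type]
  simp [tensorOfMatrix, Module.Basis.tensorProduct_apply, TensorProduct.smul_tmul']

theorem IsMatrixRep.isRepresentation {HA HB : Type*} [NormedAddCommGroup HA]
    [InnerProductSpace ℂ HA] [FiniteDimensional ℂ HA] [NormedAddCommGroup HB]
    [InnerProductSpace ℂ HB] [FiniteDimensional ℂ HB] {E : Fin nA → Fin m → Matrix α α ℂ}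
    {G : Fin nB → Fin m → Matrix β β ℂ} {Φ : Matrix α β ℂ} (h : IsMatrixRep p E G Φ)
    (a : OrthonormalBasis α ℂ HA) (b : OrthonormalBasis β ℂ HB) :
    IsRepresentation p (fun x i => (LinearMap.toMatrixOrthonormal a).symm (E x i))
      (fun y j => (LinearMap.toMatrixOrthonormal b).symm (G y j)ᵀ) (tensorOfMatrix a b Φ) := by
  rw [isRepresentation_iff]
  simpa using h

end Representations

theorem IsMatrixRep.mem_qCorr {nA nB m : ℕ} {p : Tuple nA nB m} {α β : Type} [Fintype α]
    [DecidableEq α] [Fintype β] [DecidableEq β] {E : Fin nA → Fin m → Matrix α α ℂ}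
    {G : Fin nB → Fin m → Matrix β β ℂ} {Φ : Matrix α β ℂ} (h : IsMatrixRep p E G Φ) :
    p ∈ qCorr nA nB m :=
  ⟨h.mem_corr, EuclideanSpace ℂ α, EuclideanSpace ℂ β, _, _, inferInstance, _, _, inferInstance,
    _, _, _, h.isRepresentation (EuclideanSpace.basisFun α ℂ) (EuclideanSpace.basisFun β ℂ)⟩

theorem exists_isMatrixRep_of_mem_qCorr {nA nB m : ℕ} {p : Tuple nA nB m}
    (h : p ∈ qCorr nA nB m) :
    ∃ (a b : ℕ) (E : Fin nA → Fin m → Matrix (Fin a) (Fin a) ℂ)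
      (G : Fin nB → Fin m → Matrix (Fin b) (Fin b) ℂ) (Φ : Matrix (Fin a) (Fin b) ℂ),
      IsMatrixRep p E G Φ := by
  obtain ⟨_, HA, HB, _, _, _, _, _, _, E, F, φ, h⟩ := h
  obtain ⟨Φ, rfl⟩ := exists_tensorOfMatrix (stdOrthonormalBasis ℂ HA) (stdOrthonormalBasis ℂ HB) φ
  exact ⟨_, _, _, _, _, (isRepresentation_iff _ _ _ _ _).1 h⟩

/-- The direct sum of two representations, with vector √s Φ ⊕ √t Φ', has no cross terms and yields s
p + t q. -/
theorem convex_qCorr (nA nB m : ℕ) : Convex ℝ (qCorr nA nB m) := by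
  intro p hp q hq s t hs ht hst
  obtain ⟨a, b, E, G, Φ, hE, hG, hΦ, hp⟩ := exists_isMatrixRep_of_mem_qCorr hp
  obtain ⟨a', b', E', G', Φ', hE', hG', hΦ', hq⟩ := exists_isMatrixRep_of_mem_qCorr hq
  have hs' : ((√s : ℝ) : ℂ) * star ((√s : ℝ) : ℂ) = s := by
    rw [Complex.star_def, Complex.conj_ofReal, ← Complex.ofReal_mul, Real.mul_self_sqrt hs]
  have ht' : ((√t : ℝ) : ℂ) * star ((√t : ℝ) : ℂ) = t := by
    rw [Complex.star_def, Complex.conj_ofReal, ← Complex.ofReal_mul, Real.mul_self_sqrt ht]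
  refine IsMatrixRep.mem_qCorr (E := fun x i => fromBlocks (E x i) 0 0 (E' x i))
    (G := fun y j => fromBlocks (G y j) 0 0 (G' y j))
    (Φ := fromBlocks (((√s : ℝ) : ℂ) • Φ) 0 0 (((√t : ℝ) : ℂ) • Φ'))
    ⟨fun x => (hE x).fromBlocks (hE' x), fun y => (hG y).fromBlocks (hG' y), ?_,
      fun i j x y => ?_⟩
  · rw [fromBlocks_conjTranspose, fromBlocks_multiply]
    simp only [conjTranspose_smul, conjTranspose_zero, Matrix.mul_zero, add_zero,
      zero_add, trace_fromBlocks_eq, Matrix.smul_mul, Matrix.mul_smul, trace_smul, hΦ, hΦ', smul_smul, hs', ht']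
    simp only [smul_eq_mul, mul_one]
    exact_mod_cast hst
  · rw [fromBlocks_conjTranspose, fromBlocks_multiply, fromBlocks_multiply, fromBlocks_multiply]
    simp only [conjTranspose_smul, conjTranspose_zero, Matrix.mul_zero, Matrix.zero_mul, add_zero,
      zero_add, trace_fromBlocks_eq, Matrix.smul_mul, Matrix.mul_smul, trace_smul, smul_smul, hs', ht',
      ← hp, ← hq, smul_eq_mul]
    simp

theorem IsMatrixRep.isNonsignalling {nA nB m : ℕ} {p : Tuple nA nB m} {α β : Type*} [Fintype α]
    [DecidableEq α] [Fintype β] [DecidableEq β] {E : Fin nA → Fin m → Matrix α α ℂ}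
    {G : Fin nB → Fin m → Matrix β β ℂ} {Φ : Matrix α β ℂ} (h : IsMatrixRep p E G Φ) :
    IsNonsignalling p := by
  obtain ⟨hE, hG, hΦ, hp⟩ := h
  have h1 : ∀ i x y, ((∑ j, p i j x y : ℝ) : ℂ) = (Φᴴ * E x i * Φ).trace := fun i x y => by
    push_cast
    simp only [hp, ← trace_sum, ← Matrix.mul_sum, (hG y).2, Matrix.mul_one]
  have h2 : ∀ j x y, ((∑ i, p i j x y : ℝ) : ℂ) = (Φᴴ * Φ * G y j).trace := fun j x y => by
    push_cast
    simp only [hp, ← trace_sum, ← Matrix.mul_sum, (hE x).2, Matrix.mul_one, ← Matrix.sum_mul]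
  exact ⟨fun i x y y' => Complex.ofReal_injective (by rw [h1, h1]),
    fun j y x x' => Complex.ofReal_injective (by rw [h2, h2])⟩

/-! ### Maximally entangled vectors and tracial representations -/

theorem tensorOfMatrix_smul_one {HA HB : Type*} [NormedAddCommGroup HA] [InnerProductSpace ℂ HA]
    [NormedAddCommGroup HB] [InnerProductSpace ℂ HB] {α : Type*} [Fintype α] [DecidableEq α]
    (a : OrthonormalBasis α ℂ HA) (b : OrthonormalBasis α ℂ HB) (c : ℂ) :
    tensorOfMatrix a b (c • (1 : Matrix α α ℂ)) = c • ∑ k, a k ⊗ₜ[ℂ] b k := by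
  rw [tensorOfMatrix, Finset.smul_sum]
  refine Finset.sum_congr rfl fun k _ => ?_
  rw [Finset.sum_eq_single k]
  · simp [TensorProduct.smul_tmul']
  · intro l _ hl
    simp [Matrix.one_apply_ne hl.symm]
  · simp

/-- The scalar by which the identity matrix of size `d` represents a maximally entangled vector. -/
noncomputable def entangledScalar (d : ℕ) : ℂ := ((1 / √(d : ℝ) : ℝ) : ℂ)

theorem entangledScalar_mul_star (d : ℕ) :
    entangledScalar d * star (entangledScalar d) = (d : ℂ)⁻¹ := by
  rw [entangledScalar, Complex.star_def, Complex.conj_ofReal, ← Complex.ofReal_mul,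
    div_mul_div_comm, Real.mul_self_sqrt (Nat.cast_nonneg d)]
  simp

/-- Tracial representations: `p(i,j|x,y) = tr(E_{x,i} E_{y,j}) / d`. -/
def IsTracialRep {n m : ℕ} (p : Tuple n n m) {α : Type*} [Fintype α] [DecidableEq α]
    (E : Fin n → Fin m → Matrix α α ℂ) : Prop :=
  (∀ x, IsMatrixPVM (E x)) ∧
    ∀ i j x y, (p i j x y : ℂ) = (Fintype.card α : ℂ)⁻¹ * (E x i * E y j).trace

section Tracial

variable {n m : ℕ} {p : Tuple n n m} {α : Type*} [Fintype α] [DecidableEq α]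
  {E : Fin n → Fin m → Matrix α α ℂ}

theorem trace_smul_one_mul (E G : Matrix α α ℂ) (d : ℕ) :
    ((entangledScalar d • (1 : Matrix α α ℂ))ᴴ * E * (entangledScalar d • 1) * G).trace =
      (d : ℂ)⁻¹ * (E * G).trace := by
  simp only [conjTranspose_smul, conjTranspose_one, Matrix.smul_mul, Matrix.mul_smul,
    Matrix.one_mul, Matrix.mul_one, smul_smul, trace_smul, entangledScalar_mul_star, smul_eq_mul]

theorem IsTracialRep.isMatrixRep [Nonempty α] (h : IsTracialRep p E) :
    IsMatrixRep p E E (entangledScalar (Fintype.card α) • 1) := by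
  refine ⟨h.1, h.1, ?_, fun i j x y => ?_⟩
  · have := trace_smul_one_mul (1 : Matrix α α ℂ) 1 (Fintype.card α)
    rw [Matrix.mul_one, Matrix.mul_one, Matrix.mul_one, trace_one] at this
    rw [this, inv_mul_cancel₀ (Nat.cast_ne_zero.2 Fintype.card_ne_zero)]
  · rw [trace_smul_one_mul, h.2]

/-- The squared norms of P k * P j sum over k to tr(P j), which the term k = j already attains; the
other terms, being nonnegative, vanish. -/
theorem IsMatrixPVM.mul_eq_zero {P : Fin m → Matrix α α ℂ} (h : IsMatrixPVM P) {i j : Fin m}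
    (hij : i ≠ j) : P i * P j = 0 := by
  have hsum : ∑ k, ((P k * P j)ᴴ * (P k * P j)).trace = (P j).trace := by
    have : ∀ k, ((P k * P j)ᴴ * (P k * P j)).trace = (P j * P k * P j).trace := fun k => by
      rw [conjTranspose_mul, h.conjTranspose, h.conjTranspose, Matrix.mul_assoc,
        ← Matrix.mul_assoc (P k), h.mul_self, Matrix.mul_assoc]
    simp only [this, ← trace_sum, ← Matrix.sum_mul, ← Matrix.mul_sum, h.2, Matrix.mul_one,
      h.mul_self]
  rw [← Finset.add_sum_erase _ _ (Finset.mem_univ j)] at hsum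
  have h0 : ((P j * P j)ᴴ * (P j * P j)).trace = (P j).trace := by
    rw [h.mul_self, h.conjTranspose, h.mul_self]
  rw [h0, add_eq_left, Finset.sum_eq_zero_iff_of_nonneg
    fun k _ => (posSemidef_conjTranspose_mul_self _).trace_nonneg] at hsum
  exact trace_conjTranspose_mul_self_eq_zero_iff.1
    (hsum i (Finset.mem_erase.2 ⟨hij, Finset.mem_univ i⟩))

theorem IsTracialRep.isSynchronous (h : IsTracialRep p E) : IsSynchronous p := by
  intro x i j hij
  have := h.2 i j x x
  rw [(h.1 x).mul_eq_zero hij, trace_zero, mul_zero] at this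
  exact_mod_cast this

theorem IsTracialRep.submatrix {β : Type*} [Fintype β] [DecidableEq β] (h : IsTracialRep p E)
    (e : β ≃ α) : IsTracialRep p fun x i => (E x i).submatrix e e := by
  refine ⟨fun x => (h.1 x).submatrix e, fun i j x y => ?_⟩
  rw [submatrix_mul_equiv, h.2, Fintype.card_congr e]
  congr 1
  simpa [trace] using (e.sum_comp fun k => (E x i * E y j) k k).symm

theorem IsTracialRep.kronecker_one {β : Type*} [Fintype β] [DecidableEq β] [Nonempty β]
    (h : IsTracialRep p E) :
    IsTracialRep p fun x i => kroneckerMap (· * ·) (E x i) (1 : Matrix β β ℂ) := by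
  refine ⟨fun x => (h.1 x).kronecker_one, fun i j x y => ?_⟩
  rw [← mul_kronecker_mul, trace_kronecker, h.2, Matrix.one_mul, trace_one, Fintype.card_prod]
  have : (Fintype.card β : ℂ) ≠ 0 := Nat.cast_ne_zero.2 Fintype.card_ne_zero
  push_cast
  rw [mul_inv]
  field_simp

end Tracial

/-- A maximally entangled vector has a nonzero scalar matrix, so intertwining identifies the second
party's transposed projections with those of the first. -/
theorem mem_maxCorrSync_iff {n m d : ℕ} (hd : 0 < d) {p : Tuple n n m} :
    p ∈ maxCorrSync n m d ↔
      ∃ E : Fin n → Fin m → Matrix (Fin d) (Fin d) ℂ, IsTracialRep p E := by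
  have : Nonempty (Fin d) := ⟨⟨0, hd⟩⟩
  constructor
  · rintro ⟨⟨_, HA, HB, _, _, _, _, _, _, E, F, φ, h, u, v, rfl⟩, hs⟩
    have h' : IsRepresentation p E F (tensorOfMatrix u v (entangledScalar d • 1)) := by
      rw [tensorOfMatrix_smul_one]
      exact h
    rw [isRepresentation_iff] at h'
    refine ⟨_, h'.1, fun i j x y => ?_⟩
    have hne : entangledScalar d ≠ 0 := fun h0 => by
      have := entangledScalar_mul_star d
      rw [h0, zero_mul] at this
      exact inv_ne_zero (Nat.cast_ne_zero.2 hd.ne') this.symm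
    have hc := (h'.1 y).intertwine (h'.2.1 y) (Φ := entangledScalar d • 1) (fun i j hij => by
      rw [← h'.2.2.2, hs y i j hij, Complex.ofReal_zero]) j
    rw [Matrix.mul_smul, Matrix.smul_mul, Matrix.mul_one, Matrix.one_mul] at hc
    rw [h'.2.2.2, trace_smul_one_mul, Fintype.card_fin, ← smul_right_injective _ hne hc]
  · rintro ⟨E, h⟩
    have hr := h.isMatrixRep
    refine ⟨⟨hr.mem_corr, EuclideanSpace ℂ (Fin d), EuclideanSpace ℂ (Fin d), _, _, inferInstance,
      _, _, inferInstance, _, _, _, hr.isRepresentation (EuclideanSpace.basisFun _ ℂ)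
        (EuclideanSpace.basisFun _ ℂ), EuclideanSpace.basisFun _ ℂ, EuclideanSpace.basisFun _ ℂ,
      ?_⟩, h.isSynchronous⟩
    rw [tensorOfMatrix_smul_one, Fintype.card_fin]
    rfl

theorem IsTracialRep.mem_maxCorrSync {n m : ℕ} {p : Tuple n n m} {α : Type*} [Fintype α]
    [DecidableEq α] [Nonempty α] {E : Fin n → Fin m → Matrix α α ℂ} (h : IsTracialRep p E) :
    p ∈ maxCorrSync n m (Fintype.card α) :=
  (mem_maxCorrSync_iff Fintype.card_pos).2 ⟨_, h.submatrix (Fintype.equivFin α).symm⟩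

theorem maxCorrSync_subset_mul (n m : ℕ) {d r : ℕ} (hd : 0 < d) (hr : 0 < r) :
    maxCorrSync n m d ⊆ maxCorrSync n m (d * r) := by
  intro p hp
  obtain ⟨E, h⟩ := (mem_maxCorrSync_iff hd).1 hp
  have : Nonempty (Fin d) := ⟨⟨0, hd⟩⟩
  have : Nonempty (Fin r) := ⟨⟨0, hr⟩⟩
  simpa using (h.kronecker_one (β := Fin r)).mem_maxCorrSync

theorem maxCorrSync_subset_of_dvd (n m : ℕ) {d e : ℕ} (he : 0 < e) (h : d ∣ e) :
    maxCorrSync n m d ⊆ maxCorrSync n m e := by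
  obtain ⟨r, rfl⟩ := h
  exact maxCorrSync_subset_mul n m (Nat.pos_of_mul_pos_right he) (Nat.pos_of_mul_pos_left he)

/-! ### Compactness and monotonicity of the hulls -/

theorem isCompact_maxCorrSync (n m : ℕ) {d : ℕ} (hd : 0 < d) : IsCompact (maxCorrSync n m d) := by
  -- The PVM axioms are closed equations, and the entries of projections are bounded by one.
  let S : Set (Fin n → Fin m → Matrix (Fin d) (Fin d) ℂ) := {E | ∀ x, IsMatrixPVM (E x)}
  have hS : IsCompact S := by
    refine IsCompact.of_isClosed_subset (s := Set.univ.pi fun _ => Set.univ.pi fun _ =>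
      Set.univ.pi fun _ => Set.univ.pi fun _ => Metric.closedBall (0 : ℂ) 1)
      (isCompact_univ_pi fun _ => isCompact_univ_pi fun _ => isCompact_univ_pi fun _ =>
        isCompact_univ_pi fun _ => isCompact_closedBall _ _) ?_ ?_
    · have : S = ⋂ x, ((⋂ k, {E | E x k * E x k = E x k} ∩ {E | (E x k)ᴴ = E x k}) ∩
          {E | ∑ k, E x k = 1}) := by
        ext E
        simp [S, IsMatrixPVM, isStarProjection_matrix_iff]
      rw [this]
      refine isClosed_iInter fun x => IsClosed.inter (isClosed_iInter fun k => IsClosed.inter ?_ ?_)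
        ?_
      all_goals exact isClosed_eq (by fun_prop) (by fun_prop)
    · intro E hE x _ k _ i _ j _
      simpa using (hE x).norm_apply_le_one k i j
  let f : (Fin n → Fin m → Matrix (Fin d) (Fin d) ℂ) → Tuple n n m :=
    fun E i j x y => ((d : ℂ)⁻¹ * (E x i * E y j).trace).re
  have hf : Continuous f := by
    refine continuous_pi fun i => continuous_pi fun j => continuous_pi fun x =>
      continuous_pi fun y => Complex.continuous_re.comp (continuous_const.mul ?_)
    exact Continuous.matrix_trace (by fun_prop)
  convert hS.image hf
  ext p
  rw [mem_maxCorrSync_iff hd]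
  constructor
  · rintro ⟨E, hE, hp⟩
    refine ⟨E, hE, ?_⟩
    ext i j x y
    have := hp i j x y
    rw [Fintype.card_fin] at this
    simp only [f]
    rw [← this, Complex.ofReal_re]
  · rintro ⟨E, hE, rfl⟩
    refine ⟨E, hE, fun i j x y => ?_⟩
    obtain ⟨r, -, hr⟩ := trace_projections_nonneg ((hE x).1 i) ((hE y).1 j)
      (entangledScalar d • (1 : Matrix (Fin d) (Fin d) ℂ))
    rw [trace_smul_one_mul] at hr
    simp only [f, Fintype.card_fin]
    rw [hr, Complex.ofReal_re]

theorem Fintype.sum_eq_sum_of_embedding {ι κ M : Type*} [Fintype ι] [Fintype κ] [AddCommMonoid M]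
    (e : ι ↪ κ) {g : ι → M} {h : κ → M} (h1 : ∀ i, h (e i) = g i)
    (h2 : ∀ k, (∀ i, e i ≠ k) → h k = 0) : ∑ k, h k = ∑ i, g i := by
  rw [← Finset.sum_congr rfl fun i _ => h1 i, ← Finset.sum_map Finset.univ e h]
  exact (Finset.sum_subset (Finset.subset_univ _) fun k _ hk =>
    h2 k fun i hi => hk (by simp [← hi])).symm

/-- The convex hull of a compact subset of a finite-dimensional space is compact. -/
theorem IsCompact.convexHull_of_finiteDimensional {V : Type*} [AddCommGroup V] [Module ℝ V]
    [TopologicalSpace V] [IsTopologicalAddGroup V] [ContinuousSMul ℝ V] [FiniteDimensional ℝ V]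
    {s : Set V} (hs : IsCompact s) : IsCompact (convexHull ℝ s) := by
  rcases s.eq_empty_or_nonempty with rfl | ⟨z₀, hz₀⟩
  · simp
  -- Carathéodory's bound on the number of points; shorter combinations are padded with weight 0 at
  -- `z₀`.
  let N := Module.finrank ℝ V + 1
  let f : (Fin N → ℝ) × (Fin N → V) → V := fun q => ∑ k, q.1 k • q.2 k
  have hf : Continuous f := by fun_prop
  have hK : IsCompact (stdSimplex ℝ (Fin N) ×ˢ Set.univ.pi fun _ : Fin N => s) :=
    (isCompact_stdSimplex ℝ _).prod (isCompact_univ_pi fun _ => hs)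
  convert hK.image hf
  apply Set.Subset.antisymm
  · intro x hx
    obtain ⟨ι, _, z, w, hz, hind, hw, hsum, rfl⟩ := eq_pos_convex_span_of_mem_convexHull hx
    have hcard : Fintype.card ι ≤ Fintype.card (Fin N) := by
      rw [Fintype.card_fin]
      exact hind.card_le_finrank_succ.trans (Nat.succ_le_succ (Submodule.finrank_le _))
    obtain ⟨e⟩ := Function.Embedding.nonempty_of_card_le hcard
    have hw' : ∀ k, (∀ i, e i ≠ k) → Function.extend e w 0 k = 0 := fun k hk => by
      rw [Function.extend_apply' _ _ _ (by simpa using hk), Pi.zero_apply]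
    refine ⟨(Function.extend e w 0, Function.extend e z fun _ => z₀), ⟨⟨fun k => ?_, ?_⟩,
      fun k _ => ?_⟩, ?_⟩
    · by_cases hk : ∃ i, e i = k
      · obtain ⟨i, rfl⟩ := hk
        exact (hw i).le.trans_eq (e.injective.extend_apply w 0 i).symm
      · exact (hw' k (by simpa using hk)).ge
    · rw [← hsum]
      exact Fintype.sum_eq_sum_of_embedding e (fun i => e.injective.extend_apply _ _ _) hw'
    · by_cases hk : ∃ i, e i = k
      · obtain ⟨i, rfl⟩ := hk
        simp only [e.injective.extend_apply]
        exact hz ⟨i, rfl⟩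
      · simp only [Function.extend_apply' _ _ _ hk]
        exact hz₀
    · refine Fintype.sum_eq_sum_of_embedding e (fun i => ?_) fun k hk => ?_
      · simp only [e.injective.extend_apply]
      · simp only [hw' k hk, zero_smul]
  · rintro _ ⟨⟨w, z⟩, ⟨hw, hz⟩, rfl⟩
    exact (convex_convexHull ℝ s).sum_mem (fun k _ => hw.1 k) hw.2
      fun k _ => subset_convexHull ℝ s (hz k trivial)

theorem isClosed_hullCorrSync (n m k : ℕ) : IsClosed (hullCorrSync n m k) :=
  (isCompact_maxCorrSync n m k.factorial_pos).convexHull_of_finiteDimensional.isClosed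

theorem hullCorrSync_mono (n m : ℕ) : Monotone (hullCorrSync n m) := fun _ l h =>
  convexHull_mono (maxCorrSync_subset_of_dvd n m l.factorial_pos (Nat.factorial_dvd_factorial h))

/-! ### The union of the hulls -/

theorem convex_setOf_isSynchronous (n m : ℕ) : Convex ℝ {p : Tuple n n m | IsSynchronous p} := by
  intro p hp q hq s t _ _ _ x i j hij
  simp [hp x i j hij, hq x i j hij]

theorem maxCorrSync_subset_qCorrSync (n m d : ℕ) : maxCorrSync n m d ⊆ qCorrSync n m := by
  rintro p ⟨⟨hp, HA, HB, _, _, _, _, _, _, E, F, φ, h, -⟩, hs⟩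
  exact ⟨⟨hp, HA, HB, _, _, _, _, _, _, E, F, φ, h⟩, hs⟩

theorem hullCorrSync_subset_qCorrSync (n m k : ℕ) : hullCorrSync n m k ⊆ qCorrSync n m :=
  convexHull_min (maxCorrSync_subset_qCorrSync n m _)
    ((convex_qCorr n n m).inter (convex_setOf_isSynchronous n m))

/-- A synchronous quantum correlation is implemented by a density matrix commuting with the
projections of the first party. -/
theorem exists_commuting_density_of_mem_qCorrSync {n m : ℕ} {p : Tuple n n m}
    (h : p ∈ qCorrSync n m) :
    ∃ (a : ℕ) (E : Fin n → Fin m → Matrix (Fin a) (Fin a) ℂ) (ρ : Matrix (Fin a) (Fin a) ℂ),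
      (∀ x, IsMatrixPVM (E x)) ∧ ρ.PosSemidef ∧ ρ.trace = 1 ∧ (∀ x i, Commute ρ (E x i)) ∧
        ∀ i j x y, (p i j x y : ℂ) = (E x i * E y j * ρ).trace := by
  obtain ⟨a, b, E, G, Φ, hE, hG, hΦ, hp⟩ := exists_isMatrixRep_of_mem_qCorr h.1
  have hc : ∀ x i, E x i * Φ = Φ * G x i := fun x => (hE x).intertwine (hG x) fun i j hij => by
    rw [← hp, h.2 x i j hij, Complex.ofReal_zero]
  have hc' : ∀ x i, Φᴴ * E x i = G x i * Φᴴ := fun x i => by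
    have := congrArg Matrix.conjTranspose (hc x i)
    rwa [conjTranspose_mul, conjTranspose_mul, (hE x).conjTranspose, (hG x).conjTranspose] at this
  -- Commutation is ΦΦᴴE = ΦGΦᴴ = EΦΦᴴ, where the middle step uses the adjoint relation `hc'`.
  refine ⟨a, E, Φ * Φᴴ, hE, posSemidef_self_mul_conjTranspose Φ, ?_, fun x i => ?_,
    fun i j x y => ?_⟩
  · rw [trace_mul_comm, hΦ]
  · rw [Commute, SemiconjBy, Matrix.mul_assoc, hc', ← Matrix.mul_assoc, ← hc, Matrix.mul_assoc]
  · rw [hp, Matrix.mul_assoc, ← hc, Matrix.mul_assoc, trace_mul_comm]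
    simp only [Matrix.mul_assoc]

/-- Diagonalising the density matrix. -/
theorem exists_commuting_diagonal_of_mem_qCorrSync {n m : ℕ} {p : Tuple n n m}
    (h : p ∈ qCorrSync n m) :
    ∃ (a : ℕ) (E : Fin n → Fin m → Matrix (Fin a) (Fin a) ℂ) (w : Fin a → ℝ),
      (∀ x, IsMatrixPVM (E x)) ∧ (∀ k, 0 ≤ w k) ∧ ∑ k, w k = 1 ∧
        (∀ x i, Commute (diagonal fun k => (w k : ℂ)) (E x i)) ∧
        ∀ i j x y, (p i j x y : ℂ) = ∑ k, w k * (E x i * E y j) k k := by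
  obtain ⟨a, E, ρ, hE, hρ, htr, hcomm, hp⟩ := exists_commuting_density_of_mem_qCorrSync h
  let f := Unitary.conjStarAlgAut ℂ (Matrix (Fin a) (Fin a) ℂ) hρ.1.eigenvectorUnitary
  have hf : f.symm ρ = diagonal fun k => (hρ.1.eigenvalues k : ℂ) := by
    rw [StarAlgEquiv.symm_apply_eq]
    exact hρ.1.spectral_theorem
  have htrace : ∀ A, (f A).trace = A.trace := fun A => by
    simp only [f, Unitary.conjStarAlgAut_apply]
    rw [trace_mul_comm, ← Matrix.mul_assoc, Unitary.coe_star_mul_self, Matrix.one_mul]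
  refine ⟨a, fun x i => f.symm (E x i), hρ.1.eigenvalues, fun x => (hE x).map f.symm,
    hρ.eigenvalues_nonneg, ?_, fun x i => ?_, fun i j x y => ?_⟩
  · have := hρ.1.trace_eq_sum_eigenvalues
    rw [htr] at this
    exact Complex.ofReal_injective (by simpa using this.symm)
  · rw [← hf]
    exact (hcomm x i).map f.symm
  · rw [hp, ← f.apply_symm_apply (E x i * E y j * ρ), htrace, map_mul, map_mul, hf]
    simp only [trace, diag_apply, mul_diagonal, mul_comm]

theorem sum_eq_sum_image_sum_subtype {α M : Type*} [Fintype α] [AddCommMonoid M] (w : α → ℝ)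
    (f : α → M) :
    ∑ k, f k = ∑ μ ∈ Finset.univ.image w, ∑ k : {k // w k = μ}, f k := by
  rw [← Finset.sum_fiberwise_of_maps_to (t := Finset.univ.image w) (g := w) (by simp)]
  exact Finset.sum_congr rfl fun μ _ => Finset.sum_subtype _ (by simp) f

/-- On each eigenspace the density is scalar, so the compressed projections give a tracial
representation. -/
theorem qCorrSync_subset_convexHull (n m : ℕ) :
    qCorrSync n m ⊆ convexHull ℝ (⋃ d : ℕ, ⋃ _ : 1 ≤ d, maxCorrSync n m d) := by
  intro p h
  obtain ⟨a, E, w, hE, hw, hsum, hcomm, hp⟩ := exists_commuting_diagonal_of_mem_qCorrSync h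
  let c : ℝ → ℕ := fun μ => Fintype.card {k // w k = μ}
  let t : Fin m → Fin m → Fin n → Fin n → ℝ → ℂ := fun i j x y μ =>
    ∑ k : {k // w k = μ}, (E x i * E y j) k.1 k.1
  let q : ℝ → Tuple n n m := fun μ i j x y => ((c μ : ℂ)⁻¹ * t i j x y μ).re
  have htr : ∀ μ i j x y, t i j x y μ =
      ((E x i).submatrix (fun k : {k // w k = μ} => k.1) (fun k : {k // w k = μ} => k.1) *
        (E y j).submatrix (fun k : {k // w k = μ} => k.1)
          (fun k : {k // w k = μ} => k.1)).trace := fun μ i j x y => by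
    rw [← submatrix_mul_of_commute_diagonal (hcomm x i)]
    rfl
  have hcompr : ∀ μ x, IsMatrixPVM fun i => (E x i).submatrix (fun k : {k // w k = μ} => k.1)
      (fun k : {k // w k = μ} => k.1) := fun μ x => (hE x).compress (hcomm x) μ
  have hreal : ∀ μ i j x y, ((q μ i j x y : ℝ) : ℂ) = (c μ : ℂ)⁻¹ * t i j x y μ :=
    fun μ i j x y => by
      obtain ⟨r, -, hr⟩ := trace_projections_nonneg ((hcompr μ x).1 i) ((hcompr μ y).1 j) 1
      rw [conjTranspose_one, Matrix.one_mul, Matrix.mul_one, ← htr] at hr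
      simp only [q]
      rw [hr, ← Complex.ofReal_natCast, ← Complex.ofReal_inv, ← Complex.ofReal_mul,
        Complex.ofReal_re]
  have hne : ∀ μ ∈ Finset.univ.image w, Nonempty {k // w k = μ} := fun μ hμ => by
    obtain ⟨k, -, hk⟩ := Finset.mem_image.1 hμ
    exact ⟨k, hk⟩
  -- The weight is eigenvalue times multiplicity, the trace of the density on the eigenspace; `c μ`
  -- cancels the normalisation in `q μ`. The kernel, if any, enters with weight 0.
  have hpq : p = ∑ μ ∈ Finset.univ.image w, (μ * c μ) • q μ := by
    ext i j x y
    apply Complex.ofReal_injective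
    rw [hp, sum_eq_sum_image_sum_subtype w]
    simp only [Finset.sum_apply, Pi.smul_apply, smul_eq_mul]
    push_cast
    refine Finset.sum_congr rfl fun μ hμ => ?_
    have := hne μ hμ
    have hc : (c μ : ℂ) ≠ 0 := Nat.cast_ne_zero.2 Fintype.card_ne_zero
    rw [hreal, mul_assoc, mul_inv_cancel_left₀ hc, Finset.mul_sum]
    exact Finset.sum_congr rfl fun k _ => by rw [k.2]
  rw [hpq]
  refine (convex_convexHull ℝ _).sum_mem (fun μ hμ => ?_) ?_ fun μ hμ => ?_
  · obtain ⟨k, -, rfl⟩ := Finset.mem_image.1 hμ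
    exact mul_nonneg (hw k) (Nat.cast_nonneg _)
  · rw [← hsum, sum_eq_sum_image_sum_subtype w]
    refine Finset.sum_congr rfl fun μ _ => ?_
    rw [Finset.sum_congr rfl fun (k : {k // w k = μ}) _ => k.2]
    simp [c, mul_comm]
  · have := hne μ hμ
    refine subset_convexHull ℝ _ (Set.mem_iUnion₂.2 ⟨c μ, Fintype.card_pos, ?_⟩)
    exact IsTracialRep.mem_maxCorrSync ⟨hcompr μ, fun i j x y => by rw [hreal, htr]⟩

theorem iUnion_hullCorrSync (n m : ℕ) :
    (⋃ k : ℕ, ⋃ _ : 1 ≤ k, hullCorrSync n m k) = qCorrSync n m := by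
  apply Set.Subset.antisymm
  · exact Set.iUnion₂_subset fun k _ => hullCorrSync_subset_qCorrSync n m k
  · refine (qCorrSync_subset_convexHull n m).trans (convexHull_min ?_ ?_)
    · refine Set.iUnion₂_mono fun d hd => ?_
      exact (maxCorrSync_subset_of_dvd n m d.factorial_pos (Nat.dvd_factorial hd le_rfl)).trans
        (subset_convexHull ℝ _)
    -- Shifting the index removes the side condition, leaving a monotone family of convex sets.
    · have : (⋃ k : ℕ, ⋃ _ : 1 ≤ k, hullCorrSync n m k) = ⋃ k : ℕ, hullCorrSync n m (k + 1) := by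
        ext p
        simp only [Set.mem_iUnion, exists_prop]
        exact ⟨fun ⟨k, hk, h⟩ => ⟨k - 1, by rwa [Nat.sub_add_cancel hk]⟩,
          fun ⟨k, h⟩ => ⟨k + 1, Nat.succ_pos k, h⟩⟩
      rw [this]
      refine Directed.convex_iUnion (Monotone.directed_le fun _ _ hkl => ?_)
        fun _ => convex_convexHull ℝ _
      exact hullCorrSync_mono n m (Nat.succ_le_succ hkl)

/-! ### Local correlations and the case k = 1 -/

theorem finite_deterministicCorr (nA nB m : ℕ) : (deterministicCorr nA nB m).Finite := by
  have h : (Set.univ.pi fun _ : Fin m => Set.univ.pi fun _ : Fin m => Set.univ.pi fun _ : Fin nA =>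
      Set.univ.pi fun _ : Fin nB => ({0, 1} : Set ℝ)).Finite :=
    Set.Finite.pi fun _ => Set.Finite.pi fun _ => Set.Finite.pi fun _ => Set.Finite.pi fun _ =>
      Set.toFinite _
  exact h.subset fun p hp i _ j _ x _ y _ => hp.2.2 i j x y

theorem locCorr_eq_convexHull (nA nB m : ℕ) :
    locCorr nA nB m = convexHull ℝ (deterministicCorr nA nB m) := by
  rw [locCorr, closedConvexHull_eq_closure_convexHull]
  exact ((finite_deterministicCorr nA nB m).isClosed_convexHull ℝ).closure_eq

/-- Synchronous tuples form a face of the set of correlations. -/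
theorem convexHull_inter_isSynchronous {n m : ℕ} {s : Set (Tuple n n m)} (hs : s ⊆ corr n n m) :
    convexHull ℝ s ∩ {p | IsSynchronous p} = convexHull ℝ (s ∩ {p | IsSynchronous p}) := by
  apply Set.Subset.antisymm
  · rintro p ⟨hp, hsync⟩
    obtain ⟨ι, _, z, w, hz, -, hw, hsum, rfl⟩ := eq_pos_convex_span_of_mem_convexHull hp
    refine (convex_convexHull ℝ _).sum_mem (fun k _ => (hw k).le) hsum fun k _ =>
      subset_convexHull ℝ _ ⟨hz ⟨k, rfl⟩, fun x i j hij => ?_⟩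
    have h0 := hsync x i j hij
    simp only [Finset.sum_apply, Pi.smul_apply, smul_eq_mul] at h0
    -- All weights are strictly positive, so a zero entry of the combination is zero in each point
    -- used.
    rw [Finset.sum_eq_zero_iff_of_nonneg fun l _ =>
      mul_nonneg (hw l).le ((hs (hz ⟨l, rfl⟩)).1 i j x x)] at h0
    exact (mul_eq_zero.1 (h0 k (Finset.mem_univ k))).resolve_left (hw k).ne'
  · exact convexHull_min (Set.inter_subset_inter_left _ (subset_convexHull ℝ s))
      ((convex_convexHull ℝ s).inter (convex_setOf_isSynchronous n m))

/-- A synchronous deterministic correlation is the product of its marginals, which are the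
values on the diagonal. -/
theorem eq_mul_of_mem_deterministicCorr {n m : ℕ} {p : Tuple n n m}
    (hp : p ∈ deterministicCorr n n m) (hs : IsSynchronous p) (i j : Fin m) (x y : Fin n) :
    p i j x y = p i i x x * p j j y y := by
  obtain ⟨⟨hnn, hsum⟩, ⟨hA, hB⟩, h01⟩ := hp
  have hrow : ∀ i x y, ∑ j, p i j x y = p i i x x := fun i x y => by
    rw [hA i x y x]
    exact Finset.sum_eq_single i (fun j _ hj => hs x i j hj.symm) (by simp)
  have hcol : ∀ j x y, ∑ i, p i j x y = p j j y y := fun j x y => by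
    rw [hB j y x y]
    exact Finset.sum_eq_single j (fun i _ hi => hs y i j hi) (by simp)
  have hle : ∀ i j x y, p i j x y ≤ p i i x x := fun i j x y => by
    rw [← hrow i x y]
    exact Finset.single_le_sum (f := fun j => p i j x y) (fun j _ => hnn i j x y)
      (Finset.mem_univ j)
  have hle' : ∀ i j x y, p i j x y ≤ p j j y y := fun i j x y => by
    rw [← hcol j x y]
    exact Finset.single_le_sum (f := fun i => p i j x y) (fun i _ => hnn i j x y)
      (Finset.mem_univ i)
  rcases h01 i i x x with hi | hi
  · rw [hi, zero_mul]
    exact le_antisymm (hi ▸ hle i j x y) (hnn i j x y)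
  rcases h01 j j y y with hj | hj
  · rw [hj, mul_zero]
    exact le_antisymm (hj ▸ hle' i j x y) (hnn i j x y)
  have hone : ∑ l, p l l y y = 1 := by
    rw [← hsum y y]
    exact Finset.sum_congr rfl fun l _ => (hrow l y y).symm
  have hzero : ∀ l, l ≠ j → p l l y y = 0 := fun l hl => by
    rw [← Finset.add_sum_erase _ _ (Finset.mem_univ j), hj, add_eq_left,
      Finset.sum_eq_zero_iff_of_nonneg fun l _ => hnn l l y y] at hone
    exact hone l (Finset.mem_erase.2 ⟨hl, Finset.mem_univ l⟩)
  -- For l ≠ j the entry p(i,l|x,y) is at most p(l,l|y,y) = 0, so the row sum reduces to p(i,j|x,y).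
  have := hrow i x y
  rw [Finset.sum_eq_single j (fun l _ hl =>
    le_antisymm (hzero l hl ▸ hle' i l x y) (hnn i l x y)) (by simp)] at this
  rw [this, hi, hj, mul_one]

/-- Projections of size one are 0 or 1 and the trace is multiplicative; conversely, the diagonal
values of a synchronous deterministic correlation serve as its projections, by the product formula.
-/
theorem maxCorrSync_one (n m : ℕ) :
    maxCorrSync n m 1 = deterministicCorr n n m ∩ {p | IsSynchronous p} := by
  ext p
  rw [mem_maxCorrSync_iff one_pos]
  constructor
  · rintro ⟨E, h⟩
    have hval : ∀ x i, E x i 0 0 = 0 ∨ E x i 0 0 = 1 := fun x i => by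
      have := congrFun (congrFun ((h.1 x).mul_self i) 0) 0
      rw [Matrix.mul_apply, Fin.sum_univ_one] at this
      -- Idempotence e² = e in the form (2e - 1)² = 1.
      rcases mul_self_eq_mul_self_iff.1 (show (2 * E x i 0 0 - 1) * (2 * E x i 0 0 - 1) = 1 * 1 by
        linear_combination 4 * this) with h1 | h1
      · exact Or.inr (by linear_combination h1 / 2)
      · exact Or.inl (by linear_combination h1 / 2)
    refine ⟨⟨h.isMatrixRep.mem_corr, h.isMatrixRep.isNonsignalling, fun i j x y => ?_⟩,
      h.isSynchronous⟩
    have hp := h.2 i j x y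
    simp only [Fintype.card_fin, Nat.cast_one, inv_one, one_mul, trace_fin_one, Matrix.mul_apply,
      Fin.sum_univ_one] at hp
    rcases hval x i with h1 | h1 <;> rcases hval y j with h2 | h2 <;> simp [h1, h2] at hp <;>
      simp [hp]
  · rintro ⟨hp, hs⟩
    refine ⟨fun x i => Matrix.of fun _ _ => (p i i x x : ℂ), fun x => ⟨fun k => ?_, ?_⟩,
      fun i j x y => ?_⟩
    · rw [isStarProjection_matrix_iff]
      constructor
      · ext a b
        rcases hp.2.2 k k x x with h | h <;> simp [Matrix.mul_apply, h]
      · ext a b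
        simp
    · ext a b
      obtain rfl := Subsingleton.elim a b
      rw [Matrix.sum_apply, Matrix.one_apply_eq]
      simp only [Matrix.of_apply]
      rw [← Complex.ofReal_sum, ← Complex.ofReal_one, ← hp.1.2 x x]
      congr 1
      exact Finset.sum_congr rfl fun i _ => (Finset.sum_eq_single i
        (fun j _ hj => hs x i j hj.symm) (by simp)).symm
    · rw [eq_mul_of_mem_deterministicCorr hp hs]
      simp [trace, Matrix.mul_apply]

theorem hullCorrSync_one (n m : ℕ) : hullCorrSync n m 1 = locCorrSync n m := by
  rw [hullCorrSync, Nat.factorial_one, maxCorrSync_one,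
    ← convexHull_inter_isSynchronous fun p hp => hp.1, ← locCorr_eq_convexHull]
  rfl

theorem theorem3p9 (n m : ℕ) :
    (∀ k : ℕ, 1 ≤ k →
      IsClosed (hullCorrSync n m k) ∧ Convex ℝ (hullCorrSync n m k) ∧
        hullCorrSync n m k ⊆ hullCorrSync n m (k + 1)) ∧
    (⋃ k : ℕ, ⋃ _ : 1 ≤ k, hullCorrSync n m k) = qCorrSync n m ∧
    hullCorrSync n m 1 = locCorrSync n m :=
  ⟨fun k _ => ⟨isClosed_hullCorrSync n m k, convex_convexHull ℝ _,
    hullCorrSync_mono n m (Nat.le_succ k)⟩, iUnion_hullCorrSync n m, hullCorrSync_one n m⟩
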